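/- (Throughout, natural numbers include $0$.) There is a single polynomial $$F(y,n,s,x,w,k,l,m,i,j,v_1,v_2,v_3)$$ with integer coefficients in $13$ variables such that, for all natural numbers $y,n,s$ with $n\ge s>0$, the relation $y=\binom{n}{s}$ holds if and only if there are natural numbers $x,w,k,l,m,i,j,v_1,v_2,v_3$ with $$F(y,n,s,x,w,k,l,m,i,j,v_1,v_2,v_3)=0.$$ That is, the binomial coefficient has a Diophantine representation with parameters $y,n,s$ and only $10$ unknowns. -/

import Mathlib

/-! For `U > 2^n` the coefficient is a base-`U` digit: the integer part of `(U+1)^n / U^s` has the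
form `n.choose s + U x`. Write `y_a(k)` for `Pell.yn`, which grows like `(2a)^(k-1)`. Then
`y_{M(U+1)}(n+1) / (y_M(n-s+1) y_{MU}(s+1))` approximates `(U+1)^n / U^s`, and for large `M` it has
the same integer part (`exists_add_one_pow_eq`, `Pell.yn_ratio_bounds`).

To save unknowns, only the numerator gets a full characterization of its index
(`Pell.eq_yn_of_isSquare_indexForm`, `Pell.exists_isSquare_indexForm`). The two denominators need
only be Pell solutions in the right residue class modulo the base minus one: the inequality makes
them smaller than the numerator, hence too small for any other index (`Pell.index_eq_or_le`). The
sizes of `U` and `M` are forced by `Pell.pow_le_of_isSquare_pellForm`.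

Each condition says that some number is a square. Pairwise coprime factors merge into one product;
the four remaining squares cost one unknown per pair (`squarePairForm`), and `signShift` adds the
inequality at no cost. A sum of two squares joins the two equations. -/

/-! ### Pell solutions: growth, divisibility, congruences. -/

/-- The form `(a² - 1) c² + 1`, whose being a square says that `c` is a Pell solution. -/
def pellForm {R : Type*} [CommRing R] (a c : R) : R := (a ^ 2 - 1) * c ^ 2 + 1

theorem map_pellForm {R S : Type*} [CommRing R] [CommRing S] (f : R →+* S) (a c : R) :
    f (pellForm a c) = pellForm (f a) (f c) := by
  simp [pellForm]

theorem pellForm_pos {a : ℤ} (ha : 1 ≤ a) (c : ℤ) : 0 < pellForm a c := by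
  have h : 0 ≤ a ^ 2 - 1 := by nlinarith
  unfold pellForm
  positivity

theorem Pell.cast_xn_sq {a : ℕ} (a1 : 1 < a) (k : ℕ) :
    (Pell.xn a1 k : ℤ) ^ 2 = pellForm (a : ℤ) (Pell.yn a1 k) := by
  have h := Pell.pell_eqz a1 k
  rw [Pell.dz_val] at h
  simp only [Pell.xz, Pell.yz, Pell.az] at h
  unfold pellForm
  linarith

theorem Pell.eq_of_sq_eq_pellForm {a : ℕ} (a1 : 1 < a) {x y : ℤ}
    (h : x ^ 2 = pellForm (a : ℤ) y) :
    ∃ k, x.natAbs = Pell.xn a1 k ∧ y.natAbs = Pell.yn a1 k := by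
  obtain ⟨k, hk⟩ := Pell.eq_pellZd a1 (⟨x.natAbs, y.natAbs⟩ : ℤ√_) (by
    have hx : x.natAbs ≠ 0 := by
      intro h0
      have := pellForm_pos (a := (a : ℤ)) (by exact_mod_cast a1.le) y
      rw [← h, Int.natAbs_eq_zero.mp h0] at this
      norm_num at this
    obtain ⟨n, hn⟩ := Nat.exists_eq_succ_of_ne_zero hx
    rw [hn]
    exact Zsqrtd.le_of_le_le (by exact_mod_cast Nat.succ_pos n) (Int.natCast_nonneg _)) (by
    change ((x.natAbs : ℕ) : ℤ) * (x.natAbs : ℕ) - _ * (y.natAbs : ℕ) * (y.natAbs : ℕ) = 1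
    rw [Pell.dz_val, Pell.az, mul_assoc, Int.natAbs_mul_self', Int.natAbs_mul_self']
    unfold pellForm at h
    linarith)
  refine ⟨k, ?_, ?_⟩
  · exact Int.natCast_inj.mp (congrArg Zsqrtd.re hk)
  · exact Int.natCast_inj.mp (congrArg Zsqrtd.im hk)

theorem Pell.isSquare_pellForm_iff {a : ℕ} (a1 : 1 < a) {c : ℕ} :
    IsSquare (pellForm (a : ℤ) c) ↔ ∃ k, c = Pell.yn a1 k := by
  constructor
  · rintro ⟨x, hx⟩
    obtain ⟨k, -, hk⟩ := Pell.eq_of_sq_eq_pellForm a1 (x := x) (y := c) (by rw [hx, sq])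
    exact ⟨k, by simpa using hk⟩
  · rintro ⟨k, rfl⟩
    exact ⟨Pell.xn a1 k, by rw [← sq, Pell.cast_xn_sq]⟩

/-- From `y_{n+2} = 2a y_{n+1} - y_n` and `0 ≤ y_n < y_{n+1}`, each ratio of consecutive solutions
lies between `2a - 1` and `2a`; this gives both this bound and `Pell.yn_upper`. -/
theorem Pell.yn_lower {a : ℕ} (a1 : 1 < a) (n : ℕ) : (2 * a - 1) ^ n ≤ Pell.yn a1 (n + 1) := by
  induction n with
  | zero => simp
  | succ n ih =>
    have h := Pell.yn_succ_succ a1 n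
    have hm := Pell.strictMono_y a1 (Nat.lt_succ_self n)
    obtain ⟨b, hb⟩ : ∃ b, 2 * a = b + 1 := ⟨2 * a - 1, by omega⟩
    rw [hb] at h ⊢
    rw [hb, Nat.add_sub_cancel] at ih
    rw [Nat.add_sub_cancel]
    have := Nat.mul_le_mul_right b ih
    rw [pow_succ]
    simp only [Nat.succ_eq_add_one] at hm
    nlinarith

theorem Pell.yn_upper {a : ℕ} (a1 : 1 < a) (n : ℕ) : Pell.yn a1 (n + 1) ≤ (2 * a) ^ n := by
  induction n with
  | zero => simp
  | succ n ih =>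
    have h := Pell.yn_succ_succ a1 n
    have := Nat.mul_le_mul_right (2 * a) ih
    rw [pow_succ]
    nlinarith

/-- A nontrivial solution `(x, y)` of the Pell equation for the nonsquare `(a² - 1) q²` gives the
solution `(x, q y)` for `a² - 1`. -/
theorem Pell.exists_dvd_yn {a : ℕ} (a1 : 1 < a) {q : ℕ} (hq : 0 < q) :
    ∃ k, 0 < k ∧ q ∣ Pell.yn a1 k := by
  have ha : (1 : ℤ) < a := by exact_mod_cast a1
  have hq' : (0 : ℤ) < q := by exact_mod_cast hq
  have hd : (0 : ℤ) < (a ^ 2 - 1) * q ^ 2 := by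
    have : (0 : ℤ) < a ^ 2 - 1 := by nlinarith
    positivity
  obtain ⟨x, y, hxy, hy⟩ := Pell.exists_of_not_isSquare hd (by
    rintro ⟨r, hr⟩
    obtain ⟨t, rfl⟩ : (q : ℤ) ∣ r :=
      (Int.pow_dvd_pow_iff two_ne_zero).mp ⟨a ^ 2 - 1, by linarith⟩
    have ht : (a : ℤ) ^ 2 - 1 = t ^ 2 :=
      mul_right_cancel₀ (pow_ne_zero 2 hq'.ne') (by linarith)
    have h1 : |t| < a := abs_lt_of_sq_lt_sq (by linarith) (by linarith)
    have h2 : t ^ 2 ≤ ((a : ℤ) - 1) ^ 2 := by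
      rw [← sq_abs t]
      exact pow_le_pow_left₀ (abs_nonneg t) (by linarith) 2
    nlinarith)
  obtain ⟨k, -, hk⟩ := Pell.eq_of_sq_eq_pellForm a1 (x := x) (y := q * y) (by
    unfold pellForm; linarith)
  refine ⟨k, Nat.pos_of_ne_zero ?_, ?_⟩
  · rintro rfl
    rw [Pell.yn_zero, Int.natAbs_eq_zero] at hk
    exact (mul_ne_zero hq'.ne' hy) hk
  · rw [← hk, Int.natAbs_mul, Int.natAbs_natCast]
    exact dvd_mul_right _ _

theorem Pell.xn_two_mul {a : ℕ} (a1 : 1 < a) (k : ℕ) :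
    Pell.xn a1 (2 * k) + 1 = 2 * Pell.xn a1 k ^ 2 := by
  have h := Pell.xn_add a1 k k
  rw [← two_mul] at h
  have h' := Pell.pell_eqz a1 k
  simp only [Pell.xz, Pell.yz] at h'
  zify at h ⊢
  linarith

theorem Pell.yn_two_mul {a : ℕ} (a1 : 1 < a) (k : ℕ) :
    Pell.yn a1 (2 * k) = 2 * Pell.xn a1 k * Pell.yn a1 k := by
  have h := Pell.yn_add a1 k k
  rw [← two_mul] at h
  rw [h]; ring

theorem Pell.cast_yn_modEq_a_sub_one {a : ℕ} (a1 : 1 < a) (k : ℕ) :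
    (Pell.yn a1 k : ℤ) ≡ k [ZMOD (a : ℤ) - 1] := by
  have h := Int.natCast_modEq_iff.mpr (Pell.yn_modEq_a_sub_one a1 k)
  rwa [Nat.cast_sub a1.le, Nat.cast_one] at h

/-- Since `x_{2k} + 1 = 2 x_k² = 2 ((a² - 1) y_k² + 1)`, the square of `y_k` determines `x_{2k}`,
and the step-down lemma for `x` applies to doubled indices. Squares make the sign of `y` irrelevant.
-/
theorem Pell.dvd_of_yn_sq_modEq {a : ℕ} (a1 : 1 < a) {i j n : ℕ} (hi : 0 < i) (hin : 2 * i ≤ n)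
    (h : (Pell.yn a1 j : ℤ) ^ 2 ≡ (Pell.yn a1 i : ℤ) ^ 2 [ZMOD Pell.xn a1 n]) :
    (2 * n : ℤ) ∣ j - i ∨ (2 * n : ℤ) ∣ j + i := by
  have hx : Pell.xn a1 (2 * j) ≡ Pell.xn a1 (2 * i) [MOD Pell.xn a1 n] := by
    apply Nat.ModEq.add_right_cancel' 1
    rw [Pell.xn_two_mul, Pell.xn_two_mul, ← Int.natCast_modEq_iff]
    push_cast
    rw [Pell.cast_xn_sq, Pell.cast_xn_sq]
    exact ((h.mul_left _).add_right _).mul_left _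
  rcases Pell.modEq_of_xn_modEq a1 (by omega) hin hx with h | h
  · left
    obtain ⟨c, hc⟩ := (Int.natCast_modEq_iff.mpr h).symm.dvd
    push_cast at hc
    exact ⟨c, by linarith⟩
  · right
    obtain ⟨c, hc⟩ := (Int.natCast_modEq_iff.mpr h).symm.dvd
    push_cast at hc
    exact ⟨c, by linarith⟩

theorem Int.isSquare_mul_iff_of_isCoprime {a b : ℤ} (ha : 0 < a) (hb : 0 < b)
    (h : IsCoprime a b) : IsSquare (a * b) ↔ IsSquare a ∧ IsSquare b := by
  constructor
  · rintro ⟨c, hc⟩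
    rw [← sq] at hc
    have key : ∀ {u v : ℤ}, 0 < u → IsCoprime u v → u * v = c ^ 2 → IsSquare u := by
      intro u v hu huv huc
      obtain ⟨r, hr | hr⟩ := Int.sq_of_isCoprime huv huc
      · exact ⟨r, by rw [hr, sq]⟩
      · nlinarith [sq_nonneg r]
    exact ⟨key ha h hc, key hb h.symm (by rw [mul_comm, hc])⟩
  · rintro ⟨h1, h2⟩
    exact h1.mul h2

/-! ### One square that characterizes the `b`-th Pell solution. -/

section Forms

variable {R S : Type*} [CommRing R] [CommRing S]

/-- A Pell form in which the second argument is divisible by `4 (pellForm a c) c²`. -/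
def periodForm (a c i : R) : R := pellForm a (4 * pellForm a c * c ^ 2 * (i + 1))

/-- A base congruent to `a` modulo `f` and to `1` modulo `f - 1`. -/
def shiftedBase (a f : R) : R := a + f * (f - a)

/-- An element congruent to `c` modulo `f` and, if `f` is `1` modulo `2 c`, to `b`
modulo `2 c`. -/
def shiftedIndex (b c f j : R) : R := c + f * (b - c) + 2 * c * f * j

/-- A product of three pairwise coprime Pell forms; it is a square for some `i` and `j` exactly if
`c` is the `b`-th Pell solution with base `a`. -/
def indexForm (a b c i j : R) : R :=
  pellForm a c * (periodForm a c i *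
    pellForm (shiftedBase a (periodForm a c i)) (shiftedIndex b c (periodForm a c i) j))

theorem map_indexForm (f : R →+* S) (a b c i j : R) :
    f (indexForm a b c i j) = indexForm (f a) (f b) (f c) (f i) (f j) := by
  have h4 : f 4 = 4 := map_ofNat f 4
  have h2 : f 2 = 2 := map_ofNat f 2
  simp [indexForm, shiftedIndex, shiftedBase, periodForm, map_pellForm, h4, h2]

theorem dvd_periodForm_sub_one (a c i : R) :
    4 * pellForm a c * c ^ 2 * (i + 1) ∣ periodForm a c i - 1 :=
  ⟨(a ^ 2 - 1) * (4 * pellForm a c * c ^ 2 * (i + 1)), by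
    rw [periodForm]
    generalize 4 * pellForm a c * c ^ 2 * (i + 1) = e
    rw [pellForm]
    ring⟩

theorem sub_one_dvd_shiftedBase_sub_one (a f : R) : f - 1 ∣ shiftedBase a f - 1 :=
  ⟨f + 1 - a, by rw [shiftedBase]; ring⟩

theorem dvd_shiftedBase_sub (a f : R) : f ∣ shiftedBase a f - a :=
  ⟨f - a, by rw [shiftedBase]; ring⟩

theorem dvd_shiftedIndex_sub (b c f j : R) : f ∣ shiftedIndex b c f j - c :=
  ⟨b - c + 2 * c * j, by rw [shiftedIndex]; ring⟩

theorem pellForm_sub_dvd {f a a' c c' : R} (ha : f ∣ a - a') (hc : f ∣ c - c') :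
    f ∣ pellForm a c - pellForm a' c' := by
  obtain ⟨u, hu⟩ := ha
  obtain ⟨v, hv⟩ := hc
  obtain rfl : a = a' + f * u := by linear_combination hu
  obtain rfl : c = c' + f * v := by linear_combination hv
  refine ⟨u * (2 * a' + f * u) * (c' + f * v) ^ 2 + (a' ^ 2 - 1) * v * (2 * c' + f * v), ?_⟩
  simp only [pellForm]
  ring

theorem isCoprime_of_dvd_sub_one {u v : R} (h : u ∣ v - 1) : IsCoprime u v := by
  obtain ⟨w, hw⟩ := h
  exact ⟨-w, 1, by linear_combination hw⟩

theorem IsCoprime.of_dvd_sub {u v w : R} (h : IsCoprime u v) (hd : u ∣ w - v) :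
    IsCoprime u w := by
  obtain ⟨e, he⟩ := hd
  rw [show w = v + u * e by linear_combination he]
  exact h.add_mul_left_right e

end Forms

theorem shiftedBase_ge {a f : ℤ} (ha : 0 ≤ a) (hf : a + 1 ≤ f) : a + f ≤ shiftedBase a f := by
  unfold shiftedBase
  nlinarith

theorem periodForm_ge {a c i : ℤ} (ha : 1 < a) (hc : 1 ≤ c) (hi : 0 ≤ i) :
    a + 1 ≤ periodForm a c i := by
  have hp := pellForm_pos ha.le c
  have h1 : 1 ≤ 4 * pellForm a c * c ^ 2 * (i + 1) := by
    have : 0 < 4 * pellForm a c * c ^ 2 * (i + 1) := by positivity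
    linarith
  unfold periodForm
  generalize 4 * pellForm a c * c ^ 2 * (i + 1) = e at h1
  unfold pellForm
  have h2 : 1 ≤ e ^ 2 := by nlinarith
  have h3 : a ≤ a ^ 2 - 1 := by nlinarith
  nlinarith

/-- Call the three factors `D`, `F`, `I`. Both `F` and the shifted base are 1 modulo `D`, so `F` and
`I` are too; modulo `F`, `I` is congruent to `D`. Hence the factors are pairwise coprime. -/
theorem isSquare_indexForm_iff {a b c i j : ℤ} (ha : 1 < a) (hc : 1 ≤ c) (hi : 0 ≤ i) :
    IsSquare (indexForm a b c i j) ↔ IsSquare (pellForm a c) ∧ IsSquare (periodForm a c i) ∧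
      IsSquare (pellForm (shiftedBase a (periodForm a c i))
        (shiftedIndex b c (periodForm a c i) j)) := by
  have hD := pellForm_pos ha.le c
  have hF := periodForm_ge ha hc hi
  have hG := shiftedBase_ge (by linarith) hF
  have hI := pellForm_pos (a := shiftedBase a (periodForm a c i)) (by linarith)
    (shiftedIndex b c (periodForm a c i) j)
  have hDF : pellForm a c ∣ periodForm a c i - 1 :=
    Dvd.dvd.trans ⟨4 * c ^ 2 * (i + 1), by ring⟩ (dvd_periodForm_sub_one a c i)
  have hDG := hDF.trans (sub_one_dvd_shiftedBase_sub_one a (periodForm a c i))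
  have hcDF := isCoprime_of_dvd_sub_one hDF
  have hcDI : IsCoprime (pellForm a c) (pellForm (shiftedBase a (periodForm a c i))
      (shiftedIndex b c (periodForm a c i) j)) := by
    apply isCoprime_of_dvd_sub_one
    have := pellForm_sub_dvd hDG
      (Dvd.intro_left 0 (by ring) : pellForm a c ∣
        shiftedIndex b c (periodForm a c i) j - shiftedIndex b c (periodForm a c i) j)
    simpa [pellForm] using this
  have hcFI := hcDF.symm.of_dvd_sub (pellForm_sub_dvd (dvd_shiftedBase_sub a (periodForm a c i))
    (dvd_shiftedIndex_sub b c (periodForm a c i) j))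
  rw [indexForm, Int.isSquare_mul_iff_of_isCoprime hD (mul_pos (by linarith) hI) (hcDF.mul_right hcDI),
    Int.isSquare_mul_iff_of_isCoprime (by linarith) hI hcFI]

/-- The squares give `c = y_a(k)`, `F = x_a(n)²` and `|H| = y_g(m)`, with `g` the shifted base and
`H` the shifted index. Modulo `x_a(n)`, `g ≡ a` and `H ≡ c`, so `m ≡ ±k` modulo `2n`, a multiple of
`2c`. Modulo `2c`, `g ≡ 1` and `H ≡ b`, so `m ≡ ±b`. Thus `k ≡ ±b` modulo `2c`, while `0 < k, b ≤
c`. -/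
theorem Pell.eq_yn_of_isSquare_indexForm {a : ℕ} (a1 : 1 < a) {b c i j : ℕ} (hb : 0 < b)
    (hbc : b ≤ c) (h : IsSquare (indexForm (a : ℤ) b c i j)) : c = Pell.yn a1 b := by
  have ha : (1 : ℤ) < a := by exact_mod_cast a1
  have hc : (1 : ℤ) ≤ c := by exact_mod_cast hb.trans_le hbc
  have hi : (0 : ℤ) ≤ i := Int.natCast_nonneg i
  rw [isSquare_indexForm_iff ha hc hi] at h
  obtain ⟨hD, ⟨u, hu⟩, ⟨s, hs⟩⟩ := h
  rw [← sq] at hu hs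
  have hFge := periodForm_ge ha hc hi
  have hdvd := dvd_periodForm_sub_one (a : ℤ) c i
  have hGge := shiftedBase_ge (by linarith) hFge
  have hGa := dvd_shiftedBase_sub (a : ℤ) (periodForm a c i)
  have hHc := dvd_shiftedIndex_sub (b : ℤ) c (periodForm a c i) j
  have hG1 := sub_one_dvd_shiftedBase_sub_one (a : ℤ) (periodForm a c i)
  have hHb : (2 * (c : ℤ)) ∣ shiftedIndex (b : ℤ) c (periodForm a c i) j - b := by
    obtain ⟨e, he⟩ := hdvd
    refine ⟨2 * pellForm (a : ℤ) c * c * (i + 1) * e * (b - c) + periodForm (a : ℤ) c i * j, ?_⟩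
    rw [shiftedIndex]
    linear_combination ((b : ℤ) - c) * he
  have hG1' : (2 * c : ℤ) ∣ shiftedBase (a : ℤ) (periodForm a c i) - 1 :=
    (Dvd.dvd.trans ⟨2 * pellForm (a : ℤ) c * c * (i + 1), by ring⟩ hdvd).trans hG1
  obtain ⟨k, rfl⟩ := (Pell.isSquare_pellForm_iff a1).mp hD
  obtain ⟨n, hn, hnE⟩ := Pell.eq_of_sq_eq_pellForm a1 hu.symm
  set F := periodForm (a : ℤ) (Pell.yn a1 k) i with hF
  set H := shiftedIndex (b : ℤ) (Pell.yn a1 k) F j with hH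
  obtain ⟨g, hg⟩ : ∃ g : ℕ, shiftedBase (a : ℤ) F = g := ⟨_, (Int.toNat_of_nonneg (by linarith)).symm⟩
  rw [hg] at hs hGge hGa hG1'
  have g1 : 1 < g := by zify; linarith
  obtain ⟨m, -, hm⟩ := Pell.eq_of_sq_eq_pellForm g1 hs.symm
  have hk : 0 < k := by
    rcases Nat.eq_zero_or_pos k with rfl | hk
    · simp at hc
    · exact hk
  -- the index of the auxiliary solution is large and divisible by `c`
  have hE : (Pell.yn a1 n : ℤ) =
      4 * pellForm (a : ℤ) (Pell.yn a1 k) * (Pell.yn a1 k : ℤ) ^ 2 * (i + 1) := by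
    rw [← hnE, Int.natCast_natAbs, abs_of_nonneg]
    have := pellForm_pos ha.le (Pell.yn a1 k)
    positivity
  have hcn : Pell.yn a1 k ∣ n := by
    apply Pell.dvd_of_ysq_dvd
    zify
    exact ⟨4 * pellForm (a : ℤ) (Pell.yn a1 k) * (i + 1), by rw [hE]; ring⟩
  -- Compare `y_{2k} = 2 x_k y_k` with `y_n = 4 x_k² y_k² (i + 1)`.
  have hkn : 2 * k ≤ n := by
    rw [← (Pell.strictMono_y a1).le_iff_le, Pell.yn_two_mul]
    zify
    rw [hE, ← Pell.cast_xn_sq]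
    have hx : (1 : ℤ) ≤ Pell.xn a1 k := by exact_mod_cast Pell.x_pos a1 k
    have h1 : (Pell.xn a1 k : ℤ) * Pell.yn a1 k * 2 ≤
        (Pell.xn a1 k : ℤ) * Pell.yn a1 k * (4 * (Pell.xn a1 k * Pell.yn a1 k * (i + 1))) := by
      have : (1 : ℤ) ≤ Pell.xn a1 k * Pell.yn a1 k * (i + 1) := by
        have : (0 : ℤ) < Pell.xn a1 k * Pell.yn a1 k * (i + 1) := by positivity
        linarith
      exact mul_le_mul_of_nonneg_left (by linarith) (by positivity)
    linarith
  have huF : ((Pell.xn a1 n : ℕ) : ℤ) ∣ F := by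
    rw [← hn, Int.natCast_natAbs, abs_dvd, hu]
    exact dvd_pow_self u two_ne_zero
  have hsq : (Pell.yn a1 m : ℤ) ^ 2 ≡ (Pell.yn a1 k : ℤ) ^ 2 [ZMOD Pell.xn a1 n] := by
    have h1 : (Pell.yn a1 m : ℤ) ≡ Pell.yn g1 m [ZMOD Pell.xn a1 n] := by
      rw [Int.natCast_modEq_iff]
      refine (Pell.xy_modEq_of_modEq a1 g1 ?_ m).2
      rw [← Int.natCast_modEq_iff]
      exact (Int.modEq_iff_dvd).mpr (huF.trans hGa)
    have h2 : H ≡ Pell.yn a1 k [ZMOD Pell.xn a1 n] :=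
      ((Int.modEq_iff_dvd).mpr (huF.trans hHc)).symm
    calc (Pell.yn a1 m : ℤ) ^ 2 ≡ (Pell.yn g1 m : ℤ) ^ 2 [ZMOD Pell.xn a1 n] := h1.pow 2
      _ = H ^ 2 := by rw [← hm, Int.natCast_natAbs, sq_abs]
      _ ≡ _ [ZMOD Pell.xn a1 n] := h2.pow 2
  have hcn' : (2 * (Pell.yn a1 k : ℕ) : ℤ) ∣ 2 * n :=
    mul_dvd_mul_left 2 (Int.natCast_dvd_natCast.mpr hcn)
  have hmk := Pell.dvd_of_yn_sq_modEq a1 hk hkn hsq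
  have hmH : (2 * (Pell.yn a1 k : ℕ) : ℤ) ∣ m - H.natAbs := by
    have := Pell.cast_yn_modEq_a_sub_one g1 m
    rw [← hm] at this
    exact hG1'.trans this.dvd
  have hmb : (2 * (Pell.yn a1 k : ℕ) : ℤ) ∣ m - b ∨ (2 * (Pell.yn a1 k : ℕ) : ℤ) ∣ m + b := by
    rw [Int.natCast_natAbs] at hmH
    rcases abs_choice H with h0 | h0 <;> rw [h0] at hmH <;>
      obtain ⟨u, hu⟩ := hmH <;> obtain ⟨v, hv⟩ := hHb
    · exact .inl ⟨u + v, by linear_combination hu + hv⟩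
    · exact .inr ⟨u - v, by linear_combination hu - hv⟩
  have hkb : (2 * (Pell.yn a1 k : ℕ) : ℤ) ∣ k - b ∨ (2 * (Pell.yn a1 k : ℕ) : ℤ) ∣ k + b := by
    rcases hmk with h1 | h1 <;> rcases hmb with h2 | h2 <;> replace h1 := hcn'.trans h1 <;>
      obtain ⟨u, hu⟩ := h1 <;> obtain ⟨v, hv⟩ := h2
    · exact .inl ⟨v - u, by linear_combination hv - hu⟩
    · exact .inr ⟨v - u, by linear_combination hv - hu⟩
    · exact .inr ⟨u - v, by linear_combination hu - hv⟩
    · exact .inl ⟨u - v, by linear_combination hu - hv⟩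
  have hky := Pell.yn_ge_n a1 k
  suffices k = b by rw [this]
  have hbc' : (b : ℤ) ≤ Pell.yn a1 k := by exact_mod_cast hbc
  have hky' : (k : ℤ) ≤ Pell.yn a1 k := by exact_mod_cast hky
  have hb' : (0 : ℤ) < b := by exact_mod_cast hb
  have hk' : (0 : ℤ) < k := by exact_mod_cast hk
  rcases hkb with h1 | h1
  · have := Int.eq_zero_of_abs_lt_dvd h1 (by rw [abs_lt]; constructor <;> linarith)
    omega
  -- As `k, b ≤ c`, this case leaves only `k = b = c`.
  · have := Int.le_of_dvd (by linarith) h1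
    omega

/-- Choose `i` so that the period form comes from a solution `y_n` divisible by `4 x_b² y_b²`. By
the Chinese remainder theorem modulo `2c` and `F`, the `b`-th solution for the shifted base is a
value of `shiftedIndex`. -/
theorem Pell.exists_isSquare_indexForm {a : ℕ} (a1 : 1 < a) {b : ℕ} (hb : 0 < b) :
    ∃ i j : ℕ, IsSquare (indexForm (a : ℤ) b (Pell.yn a1 b) i j) := by
  have ha : (1 : ℤ) < a := by exact_mod_cast a1
  have hbc := Pell.yn_ge_n a1 b
  have hc : (1 : ℤ) ≤ Pell.yn a1 b := by exact_mod_cast hb.trans_le hbc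
  have hc0 : 0 < Pell.yn a1 b := hb.trans_le hbc
  have hx0 := Pell.x_pos a1 b
  obtain ⟨n, hn, e, he⟩ := Pell.exists_dvd_yn a1
    (q := 4 * Pell.xn a1 b ^ 2 * Pell.yn a1 b ^ 2) (by positivity)
  have he0 : e ≠ 0 := by
    rintro rfl
    rw [mul_zero] at he
    have := Pell.yn_ge_n a1 n
    omega
  obtain ⟨i, rfl⟩ := Nat.exists_eq_succ_of_ne_zero he0
  have hE : 4 * pellForm (a : ℤ) (Pell.yn a1 b) * (Pell.yn a1 b : ℤ) ^ 2 * ((i : ℤ) + 1) =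
      Pell.yn a1 n := by
    rw [he, ← Pell.cast_xn_sq]
    push_cast
    ring
  have hF : IsSquare (periodForm (a : ℤ) (Pell.yn a1 b) i) := by
    rw [periodForm, hE]
    exact (Pell.isSquare_pellForm_iff a1).mpr ⟨n, rfl⟩
  have hFge := periodForm_ge ha hc (Int.natCast_nonneg i)
  have hGge := shiftedBase_ge (by linarith) hFge
  have hdvd := dvd_periodForm_sub_one (a : ℤ) (Pell.yn a1 b) i
  have hGa := dvd_shiftedBase_sub (a : ℤ) (periodForm a (Pell.yn a1 b) i)
  have hG1 := sub_one_dvd_shiftedBase_sub_one (a : ℤ) (periodForm a (Pell.yn a1 b) i)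
  set F := periodForm (a : ℤ) (Pell.yn a1 b) i with hFdef
  obtain ⟨g, hg⟩ : ∃ g : ℕ, shiftedBase (a : ℤ) F = g :=
    ⟨_, (Int.toNat_of_nonneg (by linarith)).symm⟩
  rw [hg] at hGge hGa hG1
  have g1 : 1 < g := by zify; linarith
  have h2c : (2 * (Pell.yn a1 b : ℕ) : ℤ) ∣ F - 1 :=
    Dvd.dvd.trans ⟨2 * pellForm (a : ℤ) (Pell.yn a1 b) * (Pell.yn a1 b) * (i + 1), by ring⟩ hdvd
  -- the `b`-th solution for the shifted base has the required shape
  have h1 : F ∣ (Pell.yn g1 b : ℤ) - Pell.yn a1 b := by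
    obtain ⟨f, hf⟩ : ∃ f : ℕ, F = f := ⟨_, (Int.toNat_of_nonneg (by linarith)).symm⟩
    rw [hf] at hGa ⊢
    have := (Pell.xy_modEq_of_modEq a1 g1
      (Int.natCast_modEq_iff.mp ((Int.modEq_iff_dvd).mpr hGa)) b).2
    exact (Int.natCast_modEq_iff.mpr this).dvd
  have h2 : (2 * (Pell.yn a1 b : ℕ) : ℤ) ∣ (Pell.yn g1 b : ℤ) - b :=
    (h2c.trans hG1).trans (Pell.cast_yn_modEq_a_sub_one g1 b).symm.dvd
  have hcop : IsCoprime (2 * (Pell.yn a1 b : ℕ) : ℤ) F := isCoprime_of_dvd_sub_one h2c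
  have h3 : (2 * (Pell.yn a1 b : ℕ) : ℤ) * F ∣
      (Pell.yn g1 b : ℤ) - (Pell.yn a1 b + F * (b - Pell.yn a1 b)) := by
    apply hcop.mul_dvd
    · convert dvd_sub h2 (dvd_mul_of_dvd_left h2c ((b : ℤ) - Pell.yn a1 b)) using 1
      ring
    · convert dvd_sub h1 (dvd_mul_right F ((b : ℤ) - Pell.yn a1 b)) using 1
      ring
  obtain ⟨j, hj⟩ := h3
  have hmono : (Pell.yn a1 b : ℤ) ≤ Pell.yn g1 b := by
    have hag : a ≤ g := by zify; linarith
    have : ∀ n, Pell.xn a1 n ≤ Pell.xn g1 n ∧ Pell.yn a1 n ≤ Pell.yn g1 n := by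
      intro n
      induction n with
      | zero => simp
      | succ n ih =>
        have hy : Pell.yn a1 (n + 1) ≤ Pell.yn g1 (n + 1) := by
          rw [Pell.yn_succ, Pell.yn_succ]
          exact add_le_add ih.1 (Nat.mul_le_mul ih.2 hag)
        refine ⟨?_, hy⟩
        zify
        apply le_of_sq_le_sq _ (Int.natCast_nonneg _)
        rw [Pell.cast_xn_sq, Pell.cast_xn_sq]
        unfold pellForm
        gcongr
        nlinarith
    exact_mod_cast (this b).2
  -- Since `b ≤ c`, the representative `c + F (b - c)` is at most `c`, hence at most the solution
  -- for the larger base.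
  have hj0 : 0 ≤ j := by
    have hF0 : 0 < F := by linarith
    have hbc' : (b : ℤ) ≤ Pell.yn a1 b := by exact_mod_cast hbc
    have : 0 ≤ F * ((Pell.yn a1 b : ℤ) - b) := mul_nonneg hF0.le (by linarith)
    have h4 : 0 ≤ (2 * (Pell.yn a1 b : ℕ) : ℤ) * F * j := by linarith
    exact nonneg_of_mul_nonneg_right h4 (by positivity)
  obtain ⟨j, rfl⟩ := Int.eq_ofNat_of_zero_le hj0
  refine ⟨i, j, ?_⟩
  rw [isSquare_indexForm_iff ha hc (Int.natCast_nonneg i)]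
  refine ⟨(Pell.isSquare_pellForm_iff a1).mpr ⟨b, rfl⟩, hF, ?_⟩
  rw [← hFdef, hg, show shiftedIndex (b : ℤ) (Pell.yn a1 b) F j = Pell.yn g1 b by
    rw [shiftedIndex]; linear_combination -hj]
  exact (Pell.isSquare_pellForm_iff g1).mpr ⟨b, rfl⟩

/-! ### Two squares and an inequality in one equation. -/

/-- The polynomial in `z` with the roots `±√a ± (a + 1) √b`. -/
def squarePairForm {R : Type*} [CommRing R] (a b z : R) : R :=
  (z ^ 2 - a - (a + 1) ^ 2 * b) ^ 2 - 4 * (a + 1) ^ 2 * (a * b)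

theorem map_squarePairForm {R S : Type*} [CommRing R] [CommRing S] (f : R →+* S) (a b z : R) :
    f (squarePairForm a b z) = squarePairForm (f a) (f b) (f z) := by
  have h4 : f 4 = 4 := map_ofNat f 4
  simp [squarePairForm, h4]

/-- The equation makes `a b = c²` and then `b z² = (c + (a + 1) b)²`. The weight `a + 1` excludes `z
= 0`, which would need `a = (a + 1)² b`. So `b` is a square, and then so is `a`. -/
theorem isSquare_of_squarePairForm_eq_zero {a b z : ℤ} (ha : 0 < a) (hb : 0 < b)
    (h : squarePairForm a b z = 0) : IsSquare a ∧ IsSquare b := by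
  unfold squarePairForm at h
  have hdvd : (2 * (a + 1)) ∣ z ^ 2 - a - (a + 1) ^ 2 * b :=
    (Int.pow_dvd_pow_iff two_ne_zero).mp ⟨a * b, by linear_combination h⟩
  obtain ⟨c, hc⟩ := hdvd
  have hab : a * b = c ^ 2 := by
    rw [hc] at h
    have : 4 * (a + 1) ^ 2 * (a * b) = 4 * (a + 1) ^ 2 * c ^ 2 := by linear_combination -h
    exact mul_left_cancel₀ (by positivity) this
  have hbz : b * z ^ 2 = (c + (a + 1) * b) ^ 2 := by linear_combination b * hc + hab
  have hne : c + (a + 1) * b ≠ 0 := by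
    intro h0
    have : c = -((a + 1) * b) := by linarith
    rw [this] at hab
    have h1 : b * a = b * ((a + 1) ^ 2 * b) := by linarith
    have h2 := mul_left_cancel₀ hb.ne' h1
    nlinarith
  have hz : z ≠ 0 := by
    rintro rfl
    exact hne (pow_eq_zero_iff two_ne_zero |>.mp (by linarith))
  obtain ⟨t, ht⟩ : z ∣ c + (a + 1) * b :=
    (Int.pow_dvd_pow_iff two_ne_zero).mp ⟨b, by linarith⟩
  have hbt : b = t ^ 2 := by
    apply mul_left_cancel₀ (pow_ne_zero 2 hz)
    rw [ht] at hbz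
    linear_combination hbz
  have ht0 : t ≠ 0 := by
    rintro rfl
    norm_num at hbt
    omega
  obtain ⟨r, hr⟩ : t ∣ c :=
    (Int.pow_dvd_pow_iff two_ne_zero).mp ⟨a, by rw [← hab, ← hbt, mul_comm]⟩
  refine ⟨⟨r, ?_⟩, ⟨t, by rw [hbt, sq]⟩⟩
  apply mul_right_cancel₀ (pow_ne_zero 2 ht0)
  rw [← hbt, hab, hr]
  rw [hbt]
  ring

theorem abs_le_of_squarePairForm_eq_zero {a b z : ℤ} (ha : 0 < a) (hb : 0 < b)
    (h : squarePairForm a b z = 0) : |z| ≤ a + (a + 1) * b := by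
  by_contra! hz
  unfold squarePairForm at h
  have h1 : (a + (a + 1) * b) ^ 2 < z ^ 2 := by
    rw [← sq_abs z]
    exact pow_lt_pow_left₀ hz (by positivity) two_ne_zero
  have ha2 : a ≤ a ^ 2 := by nlinarith
  have hb2 : (a + 1) ^ 2 * b ≤ (a + 1) ^ 2 * b ^ 2 := by
    apply mul_le_mul_of_nonneg_left _ (by positivity)
    nlinarith
  have h2 : 2 * (a + 1) * (a * b) < z ^ 2 - a - (a + 1) ^ 2 * b := by linarith
  have h3 : (2 * (a + 1) * (a * b)) ^ 2 < (z ^ 2 - a - (a + 1) ^ 2 * b) ^ 2 :=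
    pow_lt_pow_left₀ h2 (by positivity) two_ne_zero
  have hab : a * b ≤ (a * b) ^ 2 := by
    have : 0 < a * b := by positivity
    nlinarith
  have h4 : 4 * (a + 1) ^ 2 * (a * b) ≤ 4 * (a + 1) ^ 2 * (a * b) ^ 2 :=
    mul_le_mul_of_nonneg_left hab (by positivity)
  linarith

theorem exists_squarePairForm_eq_zero {a b : ℤ} (ha : IsSquare a) (hb : IsSquare b) :
    ∃ z : ℕ, squarePairForm a b (z : ℤ) = 0 := by
  obtain ⟨r, rfl⟩ := ha
  obtain ⟨t, rfl⟩ := hb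
  refine ⟨(r + (r * r + 1) * t).natAbs, ?_⟩
  unfold squarePairForm
  rw [Int.natCast_natAbs, sq_abs]
  ring

theorem exists_squarePairForm_eq_zero_iff {a b : ℤ} (ha : 0 < a) (hb : 0 < b) :
    (∃ z : ℕ, squarePairForm a b (z : ℤ) = 0) ↔ IsSquare a ∧ IsSquare b :=
  ⟨fun ⟨_, h⟩ => isSquare_of_squarePairForm_eq_zero ha hb h,
    fun h => exists_squarePairForm_eq_zero h.1 h.2⟩

/-- Substituting this expression for the unknown of `squarePairForm` forces `0 < t`. -/
def signShift {R : Type*} [CommRing R] (a b t v : R) : R :=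
  (a + (a + 1) * b + 1) * (2 * t - 1) - v

theorem map_signShift {R S : Type*} [CommRing R] [CommRing S] (f : R →+* S) (a b t v : R) :
    f (signShift a b t v) = signShift (f a) (f b) (f t) (f v) := by
  have h2 : f 2 = 2 := map_ofNat f 2
  simp [signShift, h2]

/-- All integer roots satisfy `|z| < R` with `R = a + (a + 1) b + 1`. If `t ≤ 0`, then `R (2t - 1) -
v ≤ -R` is no root; if `t ≥ 1`, then `R (2t - 1) ≥ R` exceeds a root `z`, and the difference serves
as `v`. -/
theorem exists_squarePairForm_signShift_eq_zero_iff {a b t : ℤ} (ha : 0 < a) (hb : 0 < b) :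
    (∃ v : ℕ, squarePairForm a b (signShift a b t v) = 0) ↔
      (IsSquare a ∧ IsSquare b) ∧ 0 < t := by
  have hR : 0 < a + (a + 1) * b + 1 := by positivity
  constructor
  · rintro ⟨v, hv⟩
    refine ⟨isSquare_of_squarePairForm_eq_zero ha hb hv, ?_⟩
    have h := (abs_le.mp (abs_le_of_squarePairForm_eq_zero ha hb hv)).1
    by_contra! ht
    unfold signShift at h
    have hv0 : (0 : ℤ) ≤ v := Int.natCast_nonneg v
    nlinarith
  · rintro ⟨⟨h1, h2⟩, ht⟩
    obtain ⟨z, hz⟩ := exists_squarePairForm_eq_zero h1 h2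
    have h := (abs_le.mp (abs_le_of_squarePairForm_eq_zero ha hb hz)).2
    obtain ⟨v, hv⟩ := Int.eq_ofNat_of_zero_le
      (show 0 ≤ (a + (a + 1) * b + 1) * (2 * t - 1) - z by nlinarith)
    refine ⟨v, ?_⟩
    change squarePairForm a b (_ - ((v : ℕ) : ℤ)) = 0
    rw [← hv, sub_sub_cancel, hz]

/-! ### The binomial coefficient as a digit, and the Pell quotient. -/

theorem pow_le_pred_pow_add {x : ℤ} (hx : 1 ≤ x) (n : ℕ) :
    x ^ (n + 1) ≤ (x - 1) ^ (n + 1) + (n + 1) * x ^ n := by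
  induction n with
  | zero => simp
  | succ n ih =>
    have h1 := mul_le_mul_of_nonneg_right ih (show 0 ≤ x - 1 by linarith)
    have h2 : (0 : ℤ) ≤ (n + 1) * x ^ n := by positivity
    push_cast
    rw [pow_succ (x - 1) (n + 1)]
    have e1 : x ^ (n + 1 + 1) = x ^ (n + 1) * (x - 1) + x ^ (n + 1) := by ring
    have e2 : (n + 1 : ℤ) * x ^ (n + 1) = (n + 1) * x ^ n * (x - 1) + (n + 1) * x ^ n := by ring
    nlinarith

theorem exists_add_one_pow_eq {n s U : ℕ} (hs : 0 < s) (hsn : s ≤ n) (hU : 2 ^ n < U) :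
    ∃ q r : ℕ, (U + 1) ^ n = U ^ s * (n.choose s + U * q) + r ∧ 0 < r ∧ r < U ^ s := by
  obtain ⟨p, rfl⟩ := Nat.exists_eq_add_of_le hsn
  obtain ⟨t, rfl⟩ := Nat.exists_eq_succ_of_ne_zero hs.ne'
  have hU0 : 0 < U := (Nat.zero_le _).trans_lt hU
  refine ⟨∑ i ∈ Finset.range p, U ^ i * (t + 1 + p).choose (t + 1 + (i + 1)),
    ∑ i ∈ Finset.range (t + 1), U ^ i * (t + 1 + p).choose i, ?_, ?_, ?_⟩
  · have h : ∑ i ∈ Finset.range p,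
        U ^ (t + 1 + (i + 1)) * (t + 1 + p).choose (t + 1 + (i + 1)) = U ^ (t + 1) *
          (U * ∑ i ∈ Finset.range p, U ^ i * (t + 1 + p).choose (t + 1 + (i + 1))) := by
      rw [Finset.mul_sum, Finset.mul_sum]
      refine Finset.sum_congr rfl fun i _ => ?_
      ring
    -- Splitting the binomial sum at index `s` and peeling off the first upper term isolates the
    -- wanted coefficient.
    rw [add_pow, add_assoc, Finset.sum_range_add, Finset.sum_range_succ' _ p]
    simp only [one_pow, mul_one, Nat.cast_id, Nat.succ_eq_add_one, add_zero]
    rw [h]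
    ring
  · refine Finset.sum_pos' (fun _ _ => Nat.zero_le _) ⟨0, by simp, by simp⟩
  · calc ∑ i ∈ Finset.range (t + 1), U ^ i * (t + 1 + p).choose i
        ≤ ∑ i ∈ Finset.range (t + 1), U ^ t * (t + 1 + p).choose i := by
          refine Finset.sum_le_sum fun i hi => Nat.mul_le_mul_right _ ?_
          exact Nat.pow_le_pow_right hU0 (Nat.lt_succ_iff.mp (Finset.mem_range.mp hi))
      _ = U ^ t * ∑ i ∈ Finset.range (t + 1), (t + 1 + p).choose i := by rw [Finset.mul_sum]
      _ ≤ U ^ t * 2 ^ (t + 1 + p) := by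
          rw [← Nat.sum_range_choose]
          gcongr
          omega
      _ < U ^ (t + 1) := by
          rw [pow_succ]
          exact Nat.mul_lt_mul_of_pos_left hU (by positivity)

/-- The quotient `c / (k l)` is close to `(U+1)^n / U^s = q + r / U^s`, which is at distance at
least `1 / U^s` from both `q` and `q + 1`. The bound `M > n (U+1)^n` keeps the errors of the power
bounds below this slack. -/
theorem mul_lt_and_lt_mul_of_pow_bounds {n s p U M c k l q r : ℕ} (hn : n = p + s) (hn0 : 0 < n)
    (hU : 0 < U) (hM : n * (U + 1) ^ n < M) (hq : (U + 1) ^ n = U ^ s * q + r) (hr : 0 < r)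
    (hrU : r < U ^ s)
    (hc1 : (2 * (M * (U + 1)) - 1) ^ n ≤ c) (hc2 : c ≤ (2 * (M * (U + 1))) ^ n)
    (hk1 : (2 * M - 1) ^ p ≤ k) (hk2 : k ≤ (2 * M) ^ p)
    (hl1 : (2 * (M * U) - 1) ^ s ≤ l) (hl2 : l ≤ (2 * (M * U)) ^ s) :
    k * l * q < c ∧ c < k * l * (q + 1) := by
  obtain ⟨d, rfl⟩ := Nat.exists_eq_succ_of_ne_zero hn0.ne'
  have hM0 : 0 < M := by omega
  have hX1 : 1 ≤ 2 * M := by omega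
  have hV : 1 ≤ 2 * (M * (U + 1)) := by nlinarith
  have hXU : 1 ≤ 2 * (M * U) := by nlinarith
  have hkl2 : k * l ≤ (2 * M) ^ (d + 1) * U ^ s := by
    calc k * l ≤ (2 * M) ^ p * (2 * (M * U)) ^ s := Nat.mul_le_mul hk2 hl2
      _ = (2 * M) ^ (p + s) * U ^ s := by rw [pow_add, ← mul_assoc 2 M U, mul_pow (2 * M) U]; ring
      _ = _ := by rw [← hn]
  have hkl1 : (2 * M - 1) ^ (d + 1) * U ^ s ≤ k * l := by
    calc (2 * M - 1) ^ (d + 1) * U ^ s = (2 * M - 1) ^ p * ((2 * M - 1) * U) ^ s := by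
          rw [← Nat.succ_eq_add_one, hn, pow_add, mul_pow]; ring
      _ ≤ (2 * M - 1) ^ p * (2 * (M * U) - 1) ^ s := by
          gcongr
          rw [Nat.sub_mul, one_mul, mul_assoc]
          omega
      _ ≤ k * l := Nat.mul_le_mul hk1 hl1
  have b1 := pow_le_pred_pow_add (x := 2 * (M * (U + 1))) (by exact_mod_cast hV) d
  have b2 := pow_le_pred_pow_add (x := 2 * M) (by exact_mod_cast hX1) d
  simp only [Nat.succ_eq_add_one] at *
  clear hk1 hk2 hl1 hl2
  have hUV : U ^ s ≤ (U + 1) ^ (d + 1) :=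
    (Nat.pow_le_pow_left (Nat.le_succ U) s).trans (Nat.pow_le_pow_right (by omega) (by omega))
  zify [hX1, hV] at *
  set V : ℤ := U + 1
  set X : ℤ := 2 * M with hX
  have hXV : (2 : ℤ) * (M * V) = X * V := by rw [hX]; ring
  rw [hXV] at hc1 hc2 b1
  have hXp : 0 < X ^ d := by positivity
  have hVp : 1 ≤ V := by linarith
  have hV1 : 0 < V ^ d := by positivity
  have hd : (0 : ℤ) < d + 1 := by positivity
  have hXd : X ^ (d + 1) = X ^ d * X := pow_succ X d
  constructor
  · have h1 : (k * l * q : ℤ) ≤ X ^ (d + 1) * (U ^ s * q) := by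
      calc (k * l * q : ℤ) ≤ X ^ (d + 1) * U ^ s * q :=
            mul_le_mul_of_nonneg_right hkl2 (by positivity)
        _ = _ := by ring
    have h2 : (d + 1) * V ^ d < X * r := by
      have : V ^ d ≤ V ^ (d + 1) := pow_le_pow_right₀ hVp (Nat.le_succ d)
      have : (d + 1) * V ^ d ≤ (d + 1) * V ^ (d + 1) := mul_le_mul_of_nonneg_left this hd.le
      have : X * 1 ≤ X * r := mul_le_mul_of_nonneg_left (by linarith) (by positivity)
      linarith
    have h3 := mul_lt_mul_of_pos_left h2 hXp
    have h4 : U ^ s * q = V ^ (d + 1) - (r : ℤ) := by linarith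
    rw [h4, mul_sub, ← mul_pow] at h1
    have h5 : (d + 1) * (X * V) ^ d = X ^ d * ((d + 1) * V ^ d) := by rw [mul_pow]; ring
    have h6 : X ^ (d + 1) * (r : ℤ) = X ^ d * (X * r) := by rw [hXd]; ring
    linarith
  · have h4 : (U : ℤ) ^ s * (q + 1) = V ^ (d + 1) - r + U ^ s := by linarith
    have h1 : (X - 1) ^ (d + 1) * (V ^ (d + 1) - r + U ^ s) ≤ k * l * ((q : ℤ) + 1) := by
      rw [← h4, ← mul_assoc]
      exact mul_le_mul_of_nonneg_right hkl1 (by positivity)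
    have hW : 0 ≤ V ^ (d + 1) - r + (U : ℤ) ^ s := by rw [← h4]; positivity
    have h2 : (X ^ (d + 1) - (d + 1) * X ^ d) * (V ^ (d + 1) - r + U ^ s) ≤
        (X - 1) ^ (d + 1) * (V ^ (d + 1) - r + U ^ s) :=
      mul_le_mul_of_nonneg_right (by linarith) hW
    have h3 : (d + 1) * (V ^ (d + 1) - r + (U : ℤ) ^ s) < X * (U ^ s - r) := by
      have e1 : (d + 1) * (V ^ (d + 1) - r + (U : ℤ) ^ s) ≤ (d + 1) * (2 * V ^ (d + 1)) :=
        mul_le_mul_of_nonneg_left (by linarith) hd.le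
      have e2 : X * 1 ≤ X * ((U : ℤ) ^ s - r) :=
        mul_le_mul_of_nonneg_left (by linarith) (by positivity)
      linarith
    have h5 := mul_lt_mul_of_pos_left h3 hXp
    rw [mul_pow] at hc2
    have h6 : (X ^ (d + 1) - (d + 1) * X ^ d) * (V ^ (d + 1) - r + (U : ℤ) ^ s) =
        X ^ (d + 1) * V ^ (d + 1) + X ^ d * (X * (U ^ s - r)) -
          X ^ d * ((d + 1) * (V ^ (d + 1) - r + U ^ s)) := by rw [hXd]; ring
    linarith

/-! ### Sizes and indices from congruences modulo `a - 1`. -/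

/-- Because `y_k ≡ k` modulo `a - 1`, the divisibility passes to the positive index, so `k ≥ a - 1`
and growth does the rest. -/
theorem Pell.pow_le_of_isSquare_pellForm {a t : ℕ} (a1 : 1 < a) (ht : 0 < t)
    (hd : (a : ℤ) - 1 ∣ t) (h : IsSquare (pellForm (a : ℤ) t)) : a ^ (a - 2) ≤ t := by
  obtain ⟨k, rfl⟩ := (Pell.isSquare_pellForm_iff a1).mp h
  have hk : 0 < k := by
    rcases Nat.eq_zero_or_pos k with rfl | hk
    · simp at ht
    · exact hk
  have h1 : (a : ℤ) - 1 ∣ k := by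
    have := (Pell.cast_yn_modEq_a_sub_one a1 k).dvd
    simpa using dvd_add this hd
  have h2 := Int.le_of_dvd (by exact_mod_cast hk) h1
  obtain ⟨d, rfl⟩ := Nat.exists_eq_succ_of_ne_zero hk.ne'
  calc a ^ (a - 2) ≤ a ^ d := Nat.pow_le_pow_right (by omega) (by omega)
    _ ≤ (2 * a - 1) ^ d := Nat.pow_le_pow_left (by omega) d
    _ ≤ _ := Pell.yn_lower a1 d

theorem Pell.exists_mul_isSquare_pellForm {a b : ℕ} (hb : 0 < b) (hab : a = b + 1) :
    ∃ w : ℕ, IsSquare (pellForm (a : ℤ) (b * (w + 1))) := by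
  have a1 : 1 < a := by omega
  have h1 : (b : ℤ) ∣ Pell.yn a1 b := by
    have := (Pell.cast_yn_modEq_a_sub_one a1 b).symm.dvd
    rw [show (a : ℤ) - 1 = b by omega] at this
    simpa using dvd_add this (dvd_refl (b : ℤ))
  obtain ⟨e, he⟩ := Int.natCast_dvd_natCast.mp h1
  have he0 : e ≠ 0 := by
    rintro rfl
    have := Pell.yn_ge_n a1 b
    simp at he
    omega
  obtain ⟨w, rfl⟩ := Nat.exists_eq_succ_of_ne_zero he0
  refine ⟨w, ?_⟩
  have := (Pell.isSquare_pellForm_iff a1 (c := b * (w + 1))).mpr ⟨b, he.symm⟩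
  exact_mod_cast this

/-- The index is congruent to `p + 1` modulo `a - 1`; `p + 2 < a` rules out smaller indices, and the
next one is already at least `a`. -/
theorem Pell.index_eq_or_le {a p k t : ℕ} (a1 : 1 < a) (hp : p + 2 < a)
    (h : (Pell.yn a1 k : ℤ) = p + 1 + t * (a - 1)) : k = p + 1 ∨ a ^ (a - 1) ≤ Pell.yn a1 k := by
  have h1 := (Pell.cast_yn_modEq_a_sub_one a1 k).symm.dvd
  rw [h] at h1
  obtain ⟨e, he⟩ := h1
  have h2 : (k : ℤ) - (p + 1) = (a - 1) * (t - e) := by linear_combination -he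
  rcases lt_trichotomy ((t : ℤ) - e) 0 with h3 | h3 | h3
  · have : (a - 1 : ℤ) * (t - e) ≤ (a - 1) * (-1) :=
      mul_le_mul_of_nonneg_left (by omega) (by omega)
    omega
  · left
    rw [h3, mul_zero] at h2
    omega
  · right
    have : (a - 1 : ℤ) * 1 ≤ (a - 1) * (t - e) :=
      mul_le_mul_of_nonneg_left (by omega) (by omega)
    obtain ⟨d, rfl⟩ := Nat.exists_eq_succ_of_ne_zero (show k ≠ 0 by omega)
    calc a ^ (a - 1) ≤ a ^ d := Nat.pow_le_pow_right (by omega) (by omega)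
      _ ≤ (2 * a - 1) ^ d := Nat.pow_le_pow_left (by omega) d
      _ ≤ _ := Pell.yn_lower a1 d

theorem Pell.exists_yn_eq_add_mul {a : ℕ} (a1 : 1 < a) (b : ℕ) :
    ∃ k : ℕ, (Pell.yn a1 b : ℤ) = b + k * (a - 1) := by
  obtain ⟨e, he⟩ := (Pell.cast_yn_modEq_a_sub_one a1 b).symm.dvd
  have hb : (b : ℤ) ≤ Pell.yn a1 b := by exact_mod_cast Pell.yn_ge_n a1 b
  have he0 : 0 ≤ e := by
    by_contra! h
    have : (a - 1 : ℤ) * e ≤ (a - 1) * (-1) := mul_le_mul_of_nonneg_left (by omega) (by omega)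
    omega
  obtain ⟨k, rfl⟩ := Int.eq_ofNat_of_zero_le he0
  exact ⟨k, by rw [mul_comm]; omega⟩

/-! ### The polynomial, and its meaning for given bases. -/

section Forms

variable {R S : Type*} [CommRing R] [CommRing S]

/-- For Pell solutions `c`, `e`, `f` and the partial quotient `q`, this is positive exactly if
`0 < y` and `e f q < c < e f (q + 1)`. -/
def gapForm (y c e f q : R) : R := y * ((c - e * f * q) * (e * f * (q + 1) - c))

/-- A Diophantine representation of `y = n.choose s` relative to a base `U` and a much larger
base `M`, the size of which is guaranteed by `A` being a square. -/
def ratioForm (y n s U M A x k l m i j v₁ v₂ : R) : R :=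
  squarePairForm (indexForm (M * (U + 1)) (n + 1) (n + 1 + m) i j) A
      (signShift (indexForm (M * (U + 1)) (n + 1) (n + 1 + m) i j) A
        (gapForm y (n + 1 + m) (n - s + 1 + k * (M - 1)) (s + 1 + l * (M * U - 1))
          (y + x * U)) v₁) ^ 2 +
    squarePairForm (pellForm M (n - s + 1 + k * (M - 1)))
      (pellForm (M * U) (s + 1 + l * (M * U - 1))) v₂ ^ 2

theorem map_ratioForm (φ : R →+* S) (y n s U M A x k l m i j v₁ v₂ : R) :
    φ (ratioForm y n s U M A x k l m i j v₁ v₂) =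
      ratioForm (φ y) (φ n) (φ s) (φ U) (φ M) (φ A) (φ x) (φ k) (φ l) (φ m) (φ i) (φ j)
        (φ v₁) (φ v₂) := by
  simp [ratioForm, map_squarePairForm, map_signShift, map_indexForm, map_pellForm, gapForm]

/-- A multiple of `n + 2` which is large if `sizeSquare n w` is a square. -/
def sizeBase (n w : R) : R := (n + 2) * (w + 1)

/-- A Pell form in `sizeBase n w`. -/
def sizeSquare (n w : R) : R := pellForm (n + 3) (sizeBase n w)

/-- The smaller of the two bases. -/
def smallBase (y n w : R) : R := sizeBase n w * (y + 1)

/-- The larger base is a multiple of this number. -/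
def largeFactor (y n w : R) : R := sizeSquare n w * (smallBase y n w + n + 5)

/-- The larger of the two bases. -/
def largeBase (y n w v : R) : R := largeFactor y n w * (v + 1)

/-- If this is a square then both bases are sufficiently large. -/
def basesSquare (y n w v : R) : R :=
  sizeSquare n w * pellForm (largeFactor y n w + 1) (largeBase y n w v)

/-- A Diophantine representation of `y = n.choose s` with ten unknowns. -/
def chooseForm (y n s x w k l m i j v₁ v₂ v₃ : R) : R :=
  ratioForm y n s (smallBase y n w) (largeBase y n w v₃) (basesSquare y n w v₃)
    x k l m i j v₁ v₂

theorem map_chooseForm (φ : R →+* S) (y n s x w k l m i j v₁ v₂ v₃ : R) :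
    φ (chooseForm y n s x w k l m i j v₁ v₂ v₃) =
      chooseForm (φ y) (φ n) (φ s) (φ x) (φ w) (φ k) (φ l) (φ m) (φ i) (φ j)
        (φ v₁) (φ v₂) (φ v₃) := by
  have h2 : φ 2 = 2 := map_ofNat φ 2
  have h3 : φ 3 = 3 := map_ofNat φ 3
  have h5 : φ 5 = 5 := map_ofNat φ 5
  simp [chooseForm, map_ratioForm, basesSquare, largeBase, largeFactor, smallBase, sizeSquare,
    sizeBase, map_pellForm, h2, h3, h5]

end Forms

theorem gapForm_pos_iff {y c e f q : ℤ} (hy : 0 ≤ y) (he : 0 < e) (hf : 0 < f) :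
    0 < gapForm y c e f q ↔ 0 < y ∧ e * f * q < c ∧ c < e * f * (q + 1) := by
  have hef : 0 < e * f := mul_pos he hf
  unfold gapForm
  constructor
  · intro h
    have hy0 : 0 < y := lt_of_le_of_ne hy (by rintro rfl; simp at h)
    rcases mul_pos_iff.mp ((mul_pos_iff_of_pos_left hy0).mp h) with h1 | h1
    · exact ⟨hy0, by linarith, by linarith⟩
    · nlinarith
  · rintro ⟨h0, h1, h2⟩
    exact mul_pos h0 (mul_pos (by linarith) (by linarith))

theorem indexForm_pos {a b c i j : ℤ} (ha : 1 < a) (hc : 1 ≤ c) (hi : 0 ≤ i) :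
    0 < indexForm a b c i j := by
  have hF := periodForm_ge ha hc hi
  have hG := shiftedBase_ge (by linarith) hF
  exact mul_pos (pellForm_pos ha.le c) (mul_pos (by linarith) (pellForm_pos (by linarith) _))

theorem exists_ratioForm_eq_zero_iff {y n s U M A x k l m i j : ℤ} (ha : 1 < M * (U + 1))
    (hM : 1 ≤ M) (hMU : 1 ≤ M * U) (hc : 1 ≤ n + 1 + m) (hi : 0 ≤ i) (hA : 0 < A) :
    (∃ v₁ v₂ : ℕ, ratioForm y n s U M A x k l m i j v₁ v₂ = 0) ↔
      ((IsSquare (indexForm (M * (U + 1)) (n + 1) (n + 1 + m) i j) ∧ IsSquare A) ∧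
        0 < gapForm y (n + 1 + m) (n - s + 1 + k * (M - 1)) (s + 1 + l * (M * U - 1))
          (y + x * U)) ∧
      IsSquare (pellForm M (n - s + 1 + k * (M - 1))) ∧
        IsSquare (pellForm (M * U) (s + 1 + l * (M * U - 1))) := by
  rw [← exists_squarePairForm_signShift_eq_zero_iff (indexForm_pos ha hc hi) hA,
    ← exists_squarePairForm_eq_zero_iff (pellForm_pos hM _) (pellForm_pos hMU _)]
  simp only [ratioForm]
  constructor
  · rintro ⟨v₁, v₂, h⟩
    exact ⟨⟨v₁, by nlinarith⟩, ⟨v₂, by nlinarith⟩⟩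
  · rintro ⟨⟨v₁, h₁⟩, ⟨v₂, h₂⟩⟩
    exact ⟨v₁, v₂, by rw [h₁, h₂]; norm_num⟩

theorem largeBase_bounds {n U M : ℕ} (hn : 0 < n) (hM : (U + n + 6) ^ (n + 2) ≤ M) :
    n * (U + 1) ^ n < M ∧ U + 1 ≤ M ∧ 3 * n + 6 ≤ M := by
  have h1 : (U + 1) ^ n ≤ (U + n + 6) ^ n := Nat.pow_le_pow_left (by omega) n
  have h2 : 1 ≤ (U + n + 6) ^ n := Nat.one_le_pow _ _ (by omega)
  have h3 : (U + n + 6) ^ n * ((n + 6) * 6) ≤ M := by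
    refine le_trans ?_ hM
    rw [pow_add]
    refine Nat.mul_le_mul_left _ ?_
    rw [sq]
    exact Nat.mul_le_mul (by omega) (by omega)
  have h4 : (U + 1) ^ 1 ≤ (U + 1) ^ n := Nat.pow_le_pow_right (by omega) hn
  have h5 : n * (U + 1) ^ n ≤ n * (U + n + 6) ^ n := Nat.mul_le_mul_left n h1
  refine ⟨?_, ?_, ?_⟩ <;> nlinarith

theorem Pell.yn_ratio_bounds {n s p U M q r : ℕ} (hn : n = p + s) (hn0 : 0 < n)
    (hU : 0 < U) (hM : n * (U + 1) ^ n < M) (hq : (U + 1) ^ n = U ^ s * q + r) (hr : 0 < r)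
    (hrU : r < U ^ s) (h1 : 1 < M * (U + 1)) (h2 : 1 < M) (h3 : 1 < M * U) :
    Pell.yn h2 (p + 1) * Pell.yn h3 (s + 1) * q < Pell.yn h1 (n + 1) ∧
      Pell.yn h1 (n + 1) < Pell.yn h2 (p + 1) * Pell.yn h3 (s + 1) * (q + 1) :=
  mul_lt_and_lt_mul_of_pow_bounds hn hn0 hU hM hq hr hrU (Pell.yn_lower h1 n) (Pell.yn_upper h1 n)
    (Pell.yn_lower h2 p) (Pell.yn_upper h2 p) (Pell.yn_lower h3 s) (Pell.yn_upper h3 s)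

theorem exists_ratioForm_of_eq_choose {p s U M : ℕ} {A : ℤ} (hs : 0 < s) (hU : 2 ^ (p + s) < U)
    (hM : (U + (p + s) + 6) ^ (p + s + 2) ≤ M) (hA : 0 < A) (hA' : IsSquare A) :
    ∃ x k l m i j v₁ v₂ : ℕ, ratioForm ((p + s).choose s : ℤ) ((p + s : ℕ) : ℤ) s U M A
      x k l m i j v₁ v₂ = 0 := by
  obtain ⟨hM1, hM2, hM3⟩ := largeBase_bounds (by omega) hM
  have hU0 : 0 < U := (Nat.zero_le _).trans_lt hU
  have h2 : 1 < M := by omega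
  have h3 : 1 < M * U := by nlinarith
  have h1 : 1 < M * (U + 1) := by nlinarith
  obtain ⟨x, r, hq, hr, hrU⟩ := exists_add_one_pow_eq hs (Nat.le_add_left s p) hU
  have hgap := Pell.yn_ratio_bounds rfl (by omega) hU0 hM1 hq hr hrU h1 h2 h3
  obtain ⟨k, hk⟩ := Pell.exists_yn_eq_add_mul h2 (p + 1)
  obtain ⟨l, hl⟩ := Pell.exists_yn_eq_add_mul h3 (s + 1)
  obtain ⟨m, hm⟩ := Nat.exists_eq_add_of_le (Pell.yn_ge_n h1 (p + s + 1))
  obtain ⟨i, j, hij⟩ := Pell.exists_isSquare_indexForm h1 (b := p + s + 1) (by omega)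
  refine ⟨x, k, l, m, i, j, ?_⟩
  have eC : (((p + s : ℕ) : ℤ) + 1 + m) = Pell.yn h1 (p + s + 1) := by rw [hm]; push_cast; ring
  have eK : (((p + s : ℕ) : ℤ) - s + 1 + k * (M - 1)) = Pell.yn h2 (p + 1) := by
    rw [hk]; push_cast; ring
  have eL : ((s : ℤ) + 1 + l * (M * U - 1)) = Pell.yn h3 (s + 1) := by
    rw [hl]; push_cast; ring
  rw [exists_ratioForm_eq_zero_iff (by exact_mod_cast h1) (by exact_mod_cast h2.le)
    (by exact_mod_cast h3.le) (by omega) (by omega) hA, eC, eK, eL]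
  refine ⟨⟨⟨by exact_mod_cast hij, hA'⟩, ?_⟩, ?_, ?_⟩
  · have hpos : ∀ {a : ℕ} (a1 : 1 < a) (b : ℕ), (0 : ℤ) < Pell.yn a1 (b + 1) := fun a1 b => by
      exact_mod_cast (Nat.succ_pos b).trans_le (Pell.yn_ge_n a1 (b + 1))
    rw [gapForm_pos_iff (Int.natCast_nonneg _) (hpos h2 p) (hpos h3 s)]
    refine ⟨by exact_mod_cast Nat.choose_pos (Nat.le_add_left s p), ?_⟩
    rw [mul_comm (x : ℤ)]
    exact_mod_cast hgap
  · exact (Pell.isSquare_pellForm_iff h2).mpr ⟨_, rfl⟩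
  · have := (Pell.isSquare_pellForm_iff h3).mpr ⟨s + 1, rfl⟩
    exact_mod_cast this

/-- Once all three indices are known, `y + x U` and `n.choose s + U x'` (with `n = p + s`) are
integer parts of the same Pell quotient. Both digits are below `U`, so reduction modulo `U`
identifies them. -/
theorem eq_choose_of_ratioForm_eq_zero {y p s U M x k l m i j v₁ v₂ : ℕ} {A : ℤ}
    (hs : 0 < s) (hU : 2 ^ (p + s) < U) (hyU : y < U)
    (hM : (U + (p + s) + 6) ^ (p + s + 2) ≤ M) (hA : 0 < A)
    (h : ratioForm (y : ℤ) ((p + s : ℕ) : ℤ) s U M A x k l m i j v₁ v₂ = 0) :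
    y = (p + s).choose s := by
  obtain ⟨hM1, hM2, hM3⟩ := largeBase_bounds (by omega) hM
  have hU0 : 0 < U := (Nat.zero_le _).trans_lt hU
  have h2 : 1 < M := by omega
  have h3 : 1 < M * U := by nlinarith
  have h1 : 1 < M * (U + 1) := by nlinarith
  obtain ⟨⟨⟨hI, -⟩, hgap⟩, hK, hL⟩ := (exists_ratioForm_eq_zero_iff (by exact_mod_cast h1)
    (by exact_mod_cast h2.le) (by exact_mod_cast h3.le) (by omega) (by omega) hA).mp ⟨v₁, v₂, h⟩
  have hM1' : (0 : ℤ) ≤ k * (M - 1) := mul_nonneg (by omega) (by omega)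
  have hMU1' : (0 : ℤ) ≤ l * (M * U - 1) := by
    have : (1 : ℤ) < M * U := by exact_mod_cast h3
    exact mul_nonneg (by omega) (by omega)
  obtain ⟨K, hKe⟩ : ∃ K : ℕ, ((p + s : ℕ) : ℤ) - s + 1 + k * (M - 1) = K :=
    ⟨_, (Int.toNat_of_nonneg (by omega)).symm⟩
  obtain ⟨L, hLe⟩ : ∃ L : ℕ, (s : ℤ) + 1 + l * (M * U - 1) = L :=
    ⟨_, (Int.toNat_of_nonneg (by omega)).symm⟩
  have hCe : (((p + s : ℕ) : ℤ) + 1 + m) = ((p + s + 1 + m : ℕ) : ℤ) := by push_cast; ring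
  have hC : p + s + 1 + m = Pell.yn h1 (p + s + 1) := by
    apply Pell.eq_yn_of_isSquare_indexForm (i := i) (j := j) h1 (by omega) (by omega)
    rw [hCe] at hI
    exact_mod_cast hI
  rw [hKe] at hK hgap
  rw [hLe] at hL hgap
  rw [hCe, hC] at hgap
  have hK0 : (0 : ℤ) < K := by rw [← hKe]; push_cast; omega
  have hL0 : (0 : ℤ) < L := by omega
  rw [gapForm_pos_iff (Int.natCast_nonneg y) hK0 hL0] at hgap
  obtain ⟨hy0, hlow, hhigh⟩ := hgap
  norm_cast at hy0 hlow hhigh hK0 hL0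
  obtain ⟨k', rfl⟩ := (Pell.isSquare_pellForm_iff h2).mp hK
  obtain ⟨l', rfl⟩ := (Pell.isSquare_pellForm_iff h3).mp (by exact_mod_cast hL)
  -- the third solution is too small for the other two to have large indices
  have hCM : Pell.yn h1 (p + s + 1) ≤ M ^ (M - 1) := by
    calc Pell.yn h1 (p + s + 1) ≤ (2 * (M * (U + 1))) ^ (p + s) := Pell.yn_upper h1 _
      _ ≤ (M * (M * M)) ^ (p + s) :=
        Nat.pow_le_pow_left (Nat.mul_le_mul h2 (Nat.mul_le_mul_left M hM2)) _
      _ = M ^ (3 * (p + s)) := by rw [pow_mul]; congr 1; ring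
      _ ≤ M ^ (M - 1) := Nat.pow_le_pow_right (by omega) (by omega)
  -- Positivity comes from the factor `y` in `gapForm`; without it `K L q < C` would not bound `K`
  -- and `L`.
  have hQ : 0 < y + x * U := by omega
  have hKC : Pell.yn h2 k' < M ^ (M - 1) := by
    have : Pell.yn h2 k' ≤ Pell.yn h2 k' * Pell.yn h3 l' * (y + x * U) := by
      rw [mul_assoc]; exact Nat.le_mul_of_pos_right _ (by positivity)
    omega
  have hLC : Pell.yn h3 l' < M ^ (M - 1) := by
    have : Pell.yn h3 l' ≤ Pell.yn h2 k' * Pell.yn h3 l' * (y + x * U) := by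
      rw [mul_comm (Pell.yn h2 k'), mul_assoc]; exact Nat.le_mul_of_pos_right _ (by positivity)
    omega
  have hMMU : M ≤ M * U := Nat.le_mul_of_pos_right M hU0
  have hk' : k' = p + 1 := by
    refine (Pell.index_eq_or_le (p := p) (t := k) h2 (by omega) ?_).resolve_right (by omega)
    rw [← hKe]; push_cast; ring
  have hl' : l' = s + 1 := by
    refine (Pell.index_eq_or_le (p := s) (t := l) h3 (by omega) ?_).resolve_right ?_
    · rw [← hLe]; push_cast; ring
    · have : M ^ (M - 1) ≤ (M * U) ^ (M * U - 1) :=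
        (Nat.pow_le_pow_left hMMU _).trans (Nat.pow_le_pow_right (by omega) (by omega))
      omega
  subst hk' hl'
  obtain ⟨x', r, hq, hr, hrU⟩ := exists_add_one_pow_eq hs (Nat.le_add_left s p) hU
  have hgap := Pell.yn_ratio_bounds rfl (by omega) hU0 hM1 hq hr hrU h1 h2 h3
  have hQQ : y + x * U = (p + s).choose s + U * x' := by
    have e1 := lt_of_mul_lt_mul_left (hlow.trans hgap.2) (Nat.zero_le _)
    have e2 := lt_of_mul_lt_mul_left (hgap.1.trans hhigh) (Nat.zero_le _)
    omega
  have hchoose : (p + s).choose s < U := by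
    refine lt_of_le_of_lt ?_ hU
    rw [← Nat.sum_range_choose]
    exact Finset.single_le_sum (f := fun i => (p + s).choose i) (fun _ _ => Nat.zero_le _)
      (Finset.mem_range.mpr (by omega))
  have := congrArg (· % U) hQQ
  simpa [Nat.mod_eq_of_lt hyU, Nat.mod_eq_of_lt hchoose] using this

/-! ### Forcing the bases to be large; conclusion. -/

theorem sizeSquare_pos (n w : ℕ) : 0 < sizeSquare (n : ℤ) w := pellForm_pos (by omega) _

theorem basesSquare_pos (y n w v : ℕ) : 0 < basesSquare (y : ℤ) n w v := by
  have h := sizeSquare_pos n w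
  refine mul_pos h (pellForm_pos ?_ _)
  have : 0 ≤ largeFactor (y : ℤ) n w := by
    unfold largeFactor smallBase sizeBase
    positivity
  linarith

/-- As `largeFactor` is a multiple of `sizeSquare`, the second Pell form is 1 modulo the first,
hence coprime to it. -/
theorem isSquare_basesSquare_iff (y n w v : ℕ) : IsSquare (basesSquare (y : ℤ) n w v) ↔
    IsSquare (sizeSquare (n : ℤ) w) ∧
      IsSquare (pellForm (largeFactor (y : ℤ) n w + 1) (largeBase (y : ℤ) n w v)) := by
  have h := sizeSquare_pos n w
  have h0 : 0 ≤ largeFactor (y : ℤ) n w := by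
    unfold largeFactor smallBase sizeBase
    positivity
  refine Int.isSquare_mul_iff_of_isCoprime h (pellForm_pos (by linarith) _) ?_
  apply isCoprime_of_dvd_sub_one
  exact ⟨(smallBase (y : ℤ) n w + n + 5) * (largeFactor (y : ℤ) n w + 2) * largeBase (y : ℤ) n w v ^ 2,
    by rw [pellForm, largeFactor]; ring⟩

theorem exists_cast_largeFactor (y n w : ℕ) :
    ∃ g : ℕ, largeFactor (y : ℤ) n w = g ∧ (n + 2) * (w + 1) * (y + 1) + n + 5 ≤ g := by
  have h := sizeSquare_pos n w
  have hle : (((n + 2) * (w + 1) * (y + 1) + n + 5 : ℕ) : ℤ) ≤ largeFactor (y : ℤ) n w := by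
    unfold largeFactor smallBase sizeBase
    push_cast
    exact le_mul_of_one_le_left (by positivity) h
  obtain ⟨g, hg⟩ := Int.eq_ofNat_of_zero_le ((Int.natCast_nonneg _).trans hle)
  exact ⟨g, hg, by rw [hg] at hle; exact_mod_cast hle⟩

theorem exists_isSquare_basesSquare (y n : ℕ) :
    ∃ w v : ℕ, IsSquare (basesSquare (y : ℤ) n w v) := by
  obtain ⟨w, hw⟩ := Pell.exists_mul_isSquare_pellForm (a := n + 3) (b := n + 2) (by omega) rfl
  obtain ⟨g, hg, hle⟩ := exists_cast_largeFactor y n w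
  obtain ⟨v, hv⟩ := Pell.exists_mul_isSquare_pellForm (a := g + 1) (b := g) (by omega) rfl
  refine ⟨w, v, (isSquare_basesSquare_iff y n w v).mpr ⟨?_, ?_⟩⟩
  · unfold sizeSquare sizeBase
    exact_mod_cast hw
  · unfold largeBase
    rw [hg]
    exact_mod_cast hv

/-- The first square forces `sizeBase ≥ (n+3)^(n+1) > 2^n`, and the factor `y + 1` in `U` gives `y <
U`. The second has base `g + 1 ≥ U + n + 6`, where the summand 5 in `largeFactor` also makes the
exponent `g - 1` at least `n + 2`. -/
theorem exists_cast_bases {y n w v : ℕ} (h : IsSquare (basesSquare (y : ℤ) n w v)) :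
    ∃ U M : ℕ, smallBase (y : ℤ) n w = U ∧ largeBase (y : ℤ) n w v = M ∧ 2 ^ n < U ∧ y < U ∧
      (U + n + 6) ^ (n + 2) ≤ M := by
  obtain ⟨h1, h2⟩ := (isSquare_basesSquare_iff y n w v).mp h
  obtain ⟨g, hg, hle⟩ := exists_cast_largeFactor y n w
  have hT : (n + 3) ^ (n + 1) ≤ (n + 2) * (w + 1) := by
    refine Pell.pow_le_of_isSquare_pellForm (a := n + 3) (by omega) (by positivity)
      ⟨w + 1, by push_cast; ring⟩ ?_
    unfold sizeSquare sizeBase at h1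
    exact_mod_cast h1
  have hT' : 2 ^ (n + 1) ≤ (n + 2) * (w + 1) := (Nat.pow_le_pow_left (by omega) _).trans hT
  have hp : 0 < 2 ^ n := by positivity
  rw [pow_succ] at hT'
  refine ⟨(n + 2) * (w + 1) * (y + 1), g * (v + 1), ?_, ?_, ?_, ?_, ?_⟩
  · unfold smallBase sizeBase
    push_cast
    ring
  · unfold largeBase
    rw [hg]
    push_cast
    ring
  · nlinarith
  · nlinarith
  · generalize (n + 2) * (w + 1) * (y + 1) = U at *
    have hM : (g + 1) ^ (g + 1 - 2) ≤ g * (v + 1) := by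
      refine Pell.pow_le_of_isSquare_pellForm (a := g + 1) (by omega)
        (Nat.mul_pos (by omega) (by omega)) ⟨v + 1, by push_cast; ring⟩ ?_
      unfold largeBase at h2
      rw [hg] at h2
      exact_mod_cast h2
    calc (U + n + 6) ^ (n + 2) ≤ (g + 1) ^ (n + 2) := Nat.pow_le_pow_left (by omega) _
      _ ≤ (g + 1) ^ (g + 1 - 2) := Nat.pow_le_pow_right (by omega) (by omega)
      _ ≤ _ := hM

/-- This avoids a circle: the squareness that forces large bases is extracted using only `U > 0` and
`M > 1`. -/
theorem isSquare_of_ratioForm_eq_zero {y p s U M x k l m i j v₁ v₂ : ℕ} {A : ℤ}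
    (hU : 0 < U) (hM : 1 < M) (hA : 0 < A)
    (h : ratioForm (y : ℤ) ((p + s : ℕ) : ℤ) s U M A x k l m i j v₁ v₂ = 0) : IsSquare A :=
  ((exists_ratioForm_eq_zero_iff
    (by exact_mod_cast hM.trans_le (Nat.le_mul_of_pos_right M (Nat.succ_pos U)))
    (by exact_mod_cast hM.le) (by exact_mod_cast Nat.mul_pos (by omega) hU)
    (by omega) (by omega) hA).mp ⟨v₁, v₂, h⟩).1.1.2

theorem eq_choose_iff_exists_chooseForm_eq_zero {y n s : ℕ} (hs : 0 < s) (hsn : s ≤ n) :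
    y = n.choose s ↔ ∃ x w k l m i j v₁ v₂ v₃ : ℕ,
      chooseForm (y : ℤ) n s x w k l m i j v₁ v₂ v₃ = 0 := by
  obtain ⟨p, rfl⟩ := Nat.exists_eq_add_of_le' hsn
  constructor
  · rintro rfl
    obtain ⟨w, v₃, hA⟩ := exists_isSquare_basesSquare ((p + s).choose s) (p + s)
    obtain ⟨U, M, hU, hM, h2U, -, hUM⟩ := exists_cast_bases hA
    obtain ⟨x, k, l, m, i, j, v₁, v₂, h⟩ := exists_ratioForm_of_eq_choose hs h2U hUM
      (basesSquare_pos _ _ w v₃) hA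
    exact ⟨x, w, k, l, m, i, j, v₁, v₂, v₃, by rw [chooseForm, hU, hM, h]⟩
  · rintro ⟨x, w, k, l, m, i, j, v₁, v₂, v₃, h⟩
    rw [chooseForm] at h
    have hA0 := basesSquare_pos y (p + s) w v₃
    have hA : IsSquare (basesSquare (y : ℤ) ((p + s : ℕ) : ℤ) w v₃) := by
      obtain ⟨g, hg, hle⟩ := exists_cast_largeFactor y (p + s) w
      have hU : smallBase (y : ℤ) ((p + s : ℕ) : ℤ) w =
          (((p + s + 2) * (w + 1) * (y + 1) : ℕ) : ℤ) := by
        unfold smallBase sizeBase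
        push_cast
        ring
      have hM : largeBase (y : ℤ) ((p + s : ℕ) : ℤ) w v₃ = ((g * (v₃ + 1) : ℕ) : ℤ) := by
        unfold largeBase
        rw [hg]
        push_cast
        ring
      rw [hU, hM] at h
      exact isSquare_of_ratioForm_eq_zero (by positivity)
        (lt_of_lt_of_le (by omega : 1 < g) (Nat.le_mul_of_pos_right g (Nat.succ_pos v₃))) hA0 h
    obtain ⟨U, M, hU, hM, h2U, hyU, hUM⟩ := exists_cast_bases hA
    rw [hU, hM] at h
    exact eq_choose_of_ratioForm_eq_zero hs h2U hyU hUM hA0 h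

theorem theorem2p3 :
    ∃ F : MvPolynomial (Fin 13) ℤ,
      ∀ y n s : ℕ, 0 < s → s ≤ n →
        (y = n.choose s ↔
          ∃ x w k l m i j v₁ v₂ v₃ : ℕ,
            MvPolynomial.eval
              (![(y : ℤ), (n : ℤ), (s : ℤ), (x : ℤ), (w : ℤ), (k : ℤ), (l : ℤ), (m : ℤ),
                (i : ℤ), (j : ℤ), (v₁ : ℤ), (v₂ : ℤ), (v₃ : ℤ)] : Fin 13 → ℤ) F = 0) := by
  refine ⟨chooseForm (.X 0) (.X 1) (.X 2) (.X 3) (.X 4) (.X 5) (.X 6) (.X 7) (.X 8) (.X 9)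
    (.X 10) (.X 11) (.X 12), fun y n s hs hsn => ?_⟩
  rw [eq_choose_iff_exists_chooseForm_eq_zero hs hsn]
  simp only [map_chooseForm, MvPolynomial.eval_X]
  rfl
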